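/- Let $n\ge 1$, and let $H:\mathbb R^n\times\mathbb R^n\to\mathbb R$ be a continuous function such that * $H$ is bounded from below, and $\sup_{x}|H(x,0)|<\infty$; * for every $R>0$ there is a constant $C_R$ with $|H(x,p)-H(y,p)|\le C_R|x-y|$ and $|H(x,p)-H(x,q)|\le C_R|p-q|$ for all $x,y,p,q\in\mathbb R^n$ with $|p|,|q|\le R$; * $\inf_{x\in\mathbb R^n}H(x,p)\to+\infty$ as $|p|\to\infty$; * $H(x,p)=a(x)K(p)$, where $K(0)=0$, $a$ is bounded and uniformly continuous on $\mathbb R^n$, and $0<\alpha\le a(x)\le\beta$ for all $x\in\mathbb R^n$, for some constants $\alpha,\beta$. For an open set $\Omega\subset\mathbb R^n$, a bounded uniformly continuous function $v$ on $\overline\Omega$ is called a state-constraint viscosity solution of $v+H(x,Dv)=0$ in $\Omega$ if, for all $\varphi\in C^1(\mathbb R^n)$: (i) $v(x)+H(x,D\varphi(x))\le 0$ whenever $x\in\Omega$ and $v-\varphi$ has a local maximum over $\Omega$ at $x$; and (ii) $v(x)+H(x,D\varphi(x))\ge 0$ whenever $x\in\overline\Omega$ and $v-\varphi$ has a local minimum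 over $\overline\Omega$ at $x$. Then $u\equiv0$ is the unique bounded uniformly continuous viscosity solution of $u+H(x,Du)=0$ in $\mathbb R^n$, and there is a constant $C>0$ depending only on $H$ such that for every integer $k\ge1$ and every state-constraint viscosity solution $u_k$ of $u_k+H(x,Du_k)=0$ in $B(0,k)$, $$0\le u_k(x)\le \left(Ce^{|x|/C}\right)e^{-k/C}\qquad\text{for all }x\in\overline{B(0,k)}.$$ In particular, for every $R>0$ and every integer $k\ge 1$ with $k\ge R$, $$0\le u_k(x)\le \left(Ce^{R/C}\right)e^{-k/C}\qquad\text{for all }x\in\overline{B(0,R)}.$$ This exponential rate is optimal, in the following sense: for every $C>0$ there is an $H$ satisfying all the assumptions above such that, for every integer $k\ge1$, the unique state-constraint viscosity solution of $u_k+H(x,Du_k)=0$ in $B(0,k)$ is $u_k(x)=\left(Ce^{|x|/C}\right)e^{-k/C}$, $x\in\overline{B(0,k)}$. -/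

import Mathlib

/-- `v` is bounded and uniformly continuous on the set `S`. -/
def IsBUCOn {n : ℕ} (v : EuclideanSpace ℝ (Fin n) → ℝ)
    (S : Set (EuclideanSpace ℝ (Fin n))) : Prop :=
  UniformContinuousOn v S ∧ ∃ M : ℝ, ∀ x ∈ S, |v x| ≤ M

/-- `v ∈ BUC(Ω)` is a viscosity subsolution of `v + H(x, Dv) = 0` in `Ω`: whenever `φ` is `C¹` and
`v - φ` has a local maximum over `Ω` at `x ∈ Ω`, one has `v(x) + H(x, Dφ(x)) ≤ 0`. -/
def IsViscositySubsolution {n : ℕ}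
    (H : EuclideanSpace ℝ (Fin n) → EuclideanSpace ℝ (Fin n) → ℝ)
    (Ω : Set (EuclideanSpace ℝ (Fin n))) (v : EuclideanSpace ℝ (Fin n) → ℝ) : Prop :=
  IsBUCOn v Ω ∧
    ∀ x ∈ Ω, ∀ φ : EuclideanSpace ℝ (Fin n) → ℝ, ContDiff ℝ 1 φ →
      IsLocalMaxOn (fun y => v y - φ y) Ω x → v x + H x (gradient φ x) ≤ 0

/-- `v ∈ BUC(S)` is a viscosity supersolution of `v + H(x, Dv) = 0` on `S`, where `S` is typically
the closure of a domain: whenever `φ` is `C¹` and `v - φ` has a local minimum over `S` (relative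
to `S`, also at boundary points) at `x ∈ S`, one has `v(x) + H(x, Dφ(x)) ≥ 0`. -/
def IsViscositySupersolution {n : ℕ}
    (H : EuclideanSpace ℝ (Fin n) → EuclideanSpace ℝ (Fin n) → ℝ)
    (S : Set (EuclideanSpace ℝ (Fin n))) (v : EuclideanSpace ℝ (Fin n) → ℝ) : Prop :=
  IsBUCOn v S ∧
    ∀ x ∈ S, ∀ φ : EuclideanSpace ℝ (Fin n) → ℝ, ContDiff ℝ 1 φ →
      IsLocalMinOn (fun y => v y - φ y) S x → 0 ≤ v x + H x (gradient φ x)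

/-- State-constraint viscosity solution of `v + H(x, Dv) = 0` in `Ω`: a viscosity subsolution
in `Ω` and a viscosity supersolution on the closure of `Ω`. Only the values of `v` on the closure
of `Ω` matter. -/
def IsStateConstraintSolution {n : ℕ}
    (H : EuclideanSpace ℝ (Fin n) → EuclideanSpace ℝ (Fin n) → ℝ)
    (Ω : Set (EuclideanSpace ℝ (Fin n))) (v : EuclideanSpace ℝ (Fin n) → ℝ) : Prop :=
  IsViscositySubsolution H Ω v ∧ IsViscositySupersolution H (closure Ω) v

/-- The standing assumptions on a Hamiltonian `H(x, p)` on `ℝⁿ × ℝⁿ`. -/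
structure IsAdmissibleHamiltonian {n : ℕ}
    (H : EuclideanSpace ℝ (Fin n) → EuclideanSpace ℝ (Fin n) → ℝ) : Prop where
  /-- `H` is continuous. -/
  continuous : Continuous (fun z : EuclideanSpace ℝ (Fin n) × EuclideanSpace ℝ (Fin n) =>
    H z.1 z.2)
  /-- `H` is bounded from below. -/
  bounded_below : ∃ C₁ : ℝ, 0 < C₁ ∧ ∀ x p, -H x p ≤ C₁
  /-- `x ↦ H(x, 0)` is bounded. -/
  bounded_at_zero : ∃ C₂ : ℝ, 0 < C₂ ∧ ∀ x, |H x 0| ≤ C₂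
  /-- `H` is Lipschitz in `x` and in `p`, locally uniformly in `p`. -/
  locally_lipschitz : ∀ R : ℝ, 0 < R → ∃ C_R : ℝ, ∀ x y p q : EuclideanSpace ℝ (Fin n),
    ‖p‖ ≤ R → ‖q‖ ≤ R →
      |H x p - H y p| ≤ C_R * ‖x - y‖ ∧ |H x p - H x q| ≤ C_R * ‖p - q‖
  /-- `inf_x H(x, p) → +∞` as `|p| → ∞`. -/
  coercive : ∀ M : ℝ, ∃ r : ℝ, ∀ p : EuclideanSpace ℝ (Fin n), r ≤ ‖p‖ → ∀ x, M ≤ H x p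

/-- `H(x, p) = a(x) K(p)` with `K(0) = 0`, `a` bounded and uniformly continuous on `ℝⁿ`, and
`0 < α ≤ a ≤ β` for some constants `α`, `β`. -/
def IsProductHamiltonian {n : ℕ}
    (H : EuclideanSpace ℝ (Fin n) → EuclideanSpace ℝ (Fin n) → ℝ) : Prop :=
  ∃ (a K : EuclideanSpace ℝ (Fin n) → ℝ) (α β : ℝ),
    (∀ x p, H x p = a x * K p) ∧ K 0 = 0 ∧ IsBUCOn a Set.univ ∧
      0 < α ∧ ∀ x, α ≤ a x ∧ a x ≤ β

open Filter Topology Metric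

/-! The product form enters only through `H x 0 = 0`. On the whole space, `0` is then a solution,
and a small multiple of the smoothed norm, added to a bounded solution, makes extrema exist at
nearly zero slope, where `H` is nearly zero; this gives uniqueness.

In a ball, everything rests on one constant `C` with `-H ≤ C` everywhere and `-H ≤ C‖p‖` where `H ≤
0` (`exists_rate`). The barrier `w = C exp((‖x‖ - k)/C)` satisfies `C‖Dw‖ = w` away from the origin
and `w = C` on the sphere. If `u - w` is maximal at an interior point, `u ≤ -H(x, Dw) ≤ C‖Dw‖ = w`
there; on the sphere `u ≤ C = w`. The norm is smoothed to make `w` a test function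
(`le_exp_of_isViscositySubsolution`).

For optimality, both bounds on `-H` are made equalities where they matter: `C|‖p‖ - 1| - C` equals
`-C‖p‖` for `‖p‖ ≤ 1` and never drops below `-C`. Then `w` itself is the solution, and plane
exponential waves touching `w` from below give uniqueness. -/

theorem norm_gradient_eq {E : Type*} [NormedAddCommGroup E] [InnerProductSpace ℝ E]
    [CompleteSpace E] (f : E → ℝ) (x : E) : ‖gradient f x‖ = ‖fderiv ℝ f x‖ := by
  simp [gradient]

theorem inner_gradient_eq {E : Type*} [NormedAddCommGroup E] [InnerProductSpace ℝ E]
    [CompleteSpace E] (f : E → ℝ) (x v : E) : inner ℝ (gradient f x) v = fderiv ℝ f x v := by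
  simp [gradient]

/-- A smooth approximation from above of the norm. -/
noncomputable def smoothNorm {E : Type*} [NormedAddCommGroup E] (δ : ℝ) (x : E) : ℝ :=
  Real.sqrt (δ ^ 2 + ‖x‖ ^ 2)

section SmoothNorm

variable {E : Type*} [NormedAddCommGroup E]

theorem smoothNorm_pos {δ : ℝ} (hδ : 0 < δ) (x : E) : 0 < smoothNorm δ x :=
  Real.sqrt_pos.2 (by positivity)

theorem norm_le_smoothNorm (δ : ℝ) (x : E) : ‖x‖ ≤ smoothNorm δ x :=
  Real.le_sqrt_of_sq_le (by nlinarith [sq_nonneg δ])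

theorem smoothNorm_le {δ : ℝ} (hδ : 0 ≤ δ) (x : E) : smoothNorm δ x ≤ ‖x‖ + δ :=
  Real.sqrt_le_iff.2 ⟨by positivity, by nlinarith [mul_nonneg hδ (norm_nonneg x)]⟩

variable [InnerProductSpace ℝ E]

theorem contDiff_smoothNorm {δ : ℝ} (hδ : 0 < δ) {m : WithTop ℕ∞} :
    ContDiff ℝ m (smoothNorm δ : E → ℝ) :=
  (contDiff_const.add (contDiff_norm_sq ℝ)).sqrt fun x => by positivity

theorem differentiable_smoothNorm {δ : ℝ} (hδ : 0 < δ) :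
    Differentiable ℝ (smoothNorm δ : E → ℝ) :=
  (contDiff_smoothNorm hδ (m := 1)).differentiable (by norm_num)

theorem norm_fderiv_smoothNorm_le {δ : ℝ} (hδ : 0 < δ) (x : E) :
    ‖fderiv ℝ (smoothNorm δ) x‖ ≤ 1 := by
  have h : HasFDerivAt (smoothNorm δ : E → ℝ)
      ((1 / (2 * smoothNorm δ x)) • ((2 : ℝ) • innerSL ℝ x)) x := by
    have h1 : HasFDerivAt (fun y : E => δ ^ 2 + ‖y‖ ^ 2) ((2 : ℝ) • innerSL ℝ x) x := by
      simpa [ofNat_smul_eq_nsmul] using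
        (hasStrictFDerivAt_norm_sq x).hasFDerivAt.const_add (δ ^ 2)
    exact h1.sqrt (by positivity)
  have hg := smoothNorm_pos hδ x
  rw [h.fderiv, norm_smul, norm_smul, innerSL_apply_norm, Real.norm_of_nonneg (by positivity),
    Real.norm_of_nonneg (by positivity)]
  have : 1 / (2 * smoothNorm δ x) * (2 * ‖x‖) = ‖x‖ / smoothNorm δ x := by field_simp
  rw [this, div_le_one hg]
  exact norm_le_smoothNorm δ x

end SmoothNorm

variable {n : ℕ}

theorem tendsto_const_mul_smoothNorm_add {u : EuclideanSpace ℝ (Fin n) → ℝ} {M ε : ℝ} (hε : 0 < ε)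
    (hM : ∀ x, |u x| ≤ M) :
    Tendsto (fun x => u x + ε * smoothNorm 1 x) (cocompact (EuclideanSpace ℝ (Fin n))) atTop := by
  have h1 : Tendsto (fun x : EuclideanSpace ℝ (Fin n) => -M + ε * ‖x‖)
      (cocompact (EuclideanSpace ℝ (Fin n))) atTop :=
    tendsto_atTop_add_const_left _ _ ((tendsto_norm_cocompact_atTop).const_mul_atTop hε)
  refine tendsto_atTop_mono (fun x => ?_) h1
  have := mul_le_mul_of_nonneg_left (norm_le_smoothNorm 1 x) hε.le
  linarith [neg_le_of_abs_le (hM x)]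

/-- Near `p = 0`, a Hamiltonian vanishing at `p = 0` is Lipschitz in `p`, uniformly in `x`. -/
theorem IsAdmissibleHamiltonian.exists_abs_le
    {H : EuclideanSpace ℝ (Fin n) → EuclideanSpace ℝ (Fin n) → ℝ}
    (hH : IsAdmissibleHamiltonian H) (h0 : ∀ x, H x 0 = 0) (R : ℝ) :
    ∃ L : ℝ, 0 < L ∧ ∀ x p, ‖p‖ ≤ R → |H x p| ≤ L * ‖p‖ := by
  obtain ⟨L, hL⟩ := hH.locally_lipschitz (max R 1) (by positivity)
  refine ⟨max L 1, by positivity, fun x p hp => ?_⟩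
  have h := (hL x x p 0 (hp.trans (le_max_left _ _)) (by simp)).2
  rw [h0, sub_zero, sub_zero] at h
  exact h.trans (mul_le_mul_of_nonneg_right (le_max_left _ _) (norm_nonneg _))

theorem IsProductHamiltonian.apply_zero
    {H : EuclideanSpace ℝ (Fin n) → EuclideanSpace ℝ (Fin n) → ℝ}
    (hP : IsProductHamiltonian H) (x : EuclideanSpace ℝ (Fin n)) : H x 0 = 0 := by
  obtain ⟨a, K, α, β, h, hK, -⟩ := hP
  simp [h, hK]

/-! ### Uniqueness of the zero solution on the whole space -/

theorem nonneg_of_isViscositySupersolution_univ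
    {H : EuclideanSpace ℝ (Fin n) → EuclideanSpace ℝ (Fin n) → ℝ} {L : ℝ}
    (hL : ∀ x p, ‖p‖ ≤ 1 → |H x p| ≤ L * ‖p‖) (hL0 : 0 < L)
    {u : EuclideanSpace ℝ (Fin n) → ℝ} (hu : IsViscositySupersolution H Set.univ u)
    (x : EuclideanSpace ℝ (Fin n)) : 0 ≤ u x := by
  obtain ⟨⟨hc, M, hM⟩, hu⟩ := hu
  have hc : Continuous u := (uniformContinuousOn_univ.1 hc).continuous
  have key : ∀ ε : ℝ, 0 < ε → ε ≤ 1 → 0 ≤ u x + ε * (L + smoothNorm 1 x) := by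
    intro ε hε hε1
    obtain ⟨y, hy⟩ := (hc.add (continuous_const.mul
      (contDiff_smoothNorm one_pos (m := 1)).continuous)).exists_forall_le
      (tendsto_const_mul_smoothNorm_add hε fun x => hM x trivial)
    have h := hu y trivial (fun z => (-ε) * smoothNorm 1 z)
      (contDiff_const.mul (contDiff_smoothNorm one_pos))
      (Eventually.of_forall fun z => by have := hy z; simp at this ⊢; linarith)
    have hp : ‖gradient (fun z : EuclideanSpace ℝ (Fin n) => (-ε) * smoothNorm 1 z) y‖ ≤ ε := by
      rw [norm_gradient_eq, fderiv_const_mul (differentiable_smoothNorm one_pos y), norm_smul,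
        norm_neg, Real.norm_of_nonneg hε.le]
      exact mul_le_of_le_one_right hε.le (norm_fderiv_smoothNorm_le one_pos y)
    have h1 := le_of_abs_le (hL y _ (hp.trans hε1))
    have h2 := mul_le_mul_of_nonneg_left hp hL0.le
    have h3 := hy x
    have h4 := mul_pos hε (smoothNorm_pos one_pos y)
    simp only [Pi.add_apply, Pi.mul_apply] at h3
    linarith
  have hlim : Tendsto (fun ε : ℝ => u x + ε * (L + smoothNorm 1 x)) (𝓝[>] 0) (𝓝 (u x)) := by
    have : Continuous fun ε : ℝ => u x + ε * (L + smoothNorm 1 x) := by fun_prop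
    simpa using (this.tendsto 0).mono_left nhdsWithin_le_nhds
  refine ge_of_tendsto hlim ?_
  filter_upwards [Ioc_mem_nhdsGT one_pos] with ε hε using key ε hε.1 hε.2

/-- Reflection: `-u` is a supersolution for `-H x (-p)`. That Hamiltonian need not be coercive, so
both lemmas assume only the linear bound near `p = 0`. -/
theorem nonpos_of_isViscositySubsolution_univ
    {H : EuclideanSpace ℝ (Fin n) → EuclideanSpace ℝ (Fin n) → ℝ} {L : ℝ}
    (hL : ∀ x p, ‖p‖ ≤ 1 → |H x p| ≤ L * ‖p‖) (hL0 : 0 < L)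
    {u : EuclideanSpace ℝ (Fin n) → ℝ} (hu : IsViscositySubsolution H Set.univ u)
    (x : EuclideanSpace ℝ (Fin n)) : u x ≤ 0 := by
  obtain ⟨⟨huc, M, hM⟩, hu⟩ := hu
  have hsuper : IsViscositySupersolution (fun x p => -H x (-p)) Set.univ (fun x => -u x) := by
    refine ⟨⟨uniformContinuousOn_univ.2 (uniformContinuousOn_univ.1 huc).neg, M,
      fun x hx => by simpa using hM x hx⟩, fun y hy φ hφ hmin => ?_⟩
    have h := hu y hy (fun z => -φ z) hφ.neg (by
      filter_upwards [hmin] with z hz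
      simp at hz ⊢; linarith)
    have hg : gradient (fun z => -φ z) y = -gradient φ y := by
      simp [gradient, fderiv_fun_neg]
    rw [hg] at h
    linarith
  have := nonneg_of_isViscositySupersolution_univ (L := L)
    (fun x p hp => by simpa using hL x (-p) (by simpa using hp)) hL0 hsuper x
  linarith

theorem isStateConstraintSolution_univ_zero
    {H : EuclideanSpace ℝ (Fin n) → EuclideanSpace ℝ (Fin n) → ℝ} (h0 : ∀ x, H x 0 = 0) :
    IsStateConstraintSolution H Set.univ (fun _ => 0) := by
  have hB (S : Set (EuclideanSpace ℝ (Fin n))) : IsBUCOn (fun _ => 0) S :=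
    ⟨uniformContinuous_const.uniformContinuousOn, 0, by simp⟩
  refine ⟨⟨hB _, fun x _ φ _ h => ?_⟩, ⟨hB _, fun x _ φ _ h => ?_⟩⟩
  · have h : IsLocalMin φ x := by
      rw [IsLocalMaxOn, nhdsWithin_univ] at h
      filter_upwards [h] with z hz
      simpa using hz
    simp [gradient, h.fderiv_eq_zero, h0]
  · have h : IsLocalMax φ x := by
      rw [closure_univ, IsLocalMinOn, nhdsWithin_univ] at h
      filter_upwards [h] with z hz
      simpa using hz
    simp [gradient, h.fderiv_eq_zero, h0]

theorem isStateConstraintSolution_univ_iff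
    {H : EuclideanSpace ℝ (Fin n) → EuclideanSpace ℝ (Fin n) → ℝ}
    (hH : IsAdmissibleHamiltonian H) (h0 : ∀ x, H x 0 = 0)
    (u : EuclideanSpace ℝ (Fin n) → ℝ) :
    IsStateConstraintSolution H Set.univ u ↔ ∀ x, u x = 0 := by
  obtain ⟨L, hL0, hL⟩ := hH.exists_abs_le h0 1
  constructor
  · rintro ⟨h1, h2⟩ x
    rw [closure_univ] at h2
    exact le_antisymm (nonpos_of_isViscositySubsolution_univ hL hL0 h1 x)
      (nonneg_of_isViscositySupersolution_univ hL hL0 h2 x)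
  · intro h
    rw [show u = fun _ => 0 from funext h]
    exact isStateConstraintSolution_univ_zero h0

/-! ### Bounds and exponential decay in bounded domains -/

/-- Constants may be tested at a minimum point even on the boundary, by the state constraint. -/
theorem nonneg_of_isViscositySupersolution
    {H : EuclideanSpace ℝ (Fin n) → EuclideanSpace ℝ (Fin n) → ℝ} (h0 : ∀ x, H x 0 = 0)
    {S : Set (EuclideanSpace ℝ (Fin n))} (hS : IsCompact S)
    {u : EuclideanSpace ℝ (Fin n) → ℝ} (hu : IsViscositySupersolution H S u)
    {x : EuclideanSpace ℝ (Fin n)} (hx : x ∈ S) : 0 ≤ u x := by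
  obtain ⟨y, hy, hmin⟩ := hS.exists_isMinOn ⟨x, hx⟩ hu.1.1.continuousOn
  have h := hu.2 y hy (fun _ => 0) contDiff_const (by simpa using hmin.localize)
  have hg : gradient (fun _ : EuclideanSpace ℝ (Fin n) => (0 : ℝ)) y = 0 := by simp [gradient]
  rw [hg, h0, add_zero] at h
  exact h.trans (hmin hx)

/-- A subsolution is bounded above by the opposite of any lower bound of the Hamiltonian. -/
theorem le_of_isViscositySubsolution
    {H : EuclideanSpace ℝ (Fin n) → EuclideanSpace ℝ (Fin n) → ℝ} {C : ℝ}
    (hC : ∀ x p, -H x p ≤ C) {Ω : Set (EuclideanSpace ℝ (Fin n))} (hΩ : IsOpen Ω)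
    (hcpt : IsCompact (closure Ω)) {u : EuclideanSpace ℝ (Fin n) → ℝ}
    (hu : IsViscositySubsolution H Ω u) (huc : ContinuousOn u (closure Ω))
    {x : EuclideanSpace ℝ (Fin n)} (hx : x ∈ closure Ω) : u x ≤ C := by
  refine le_on_closure (s := Ω) (fun x hx => ?_) huc continuousOn_const hx
  obtain ⟨r, hr, hball⟩ := Metric.isOpen_iff.1 hΩ x hx
  obtain ⟨M, hM⟩ := hcpt.exists_bound_of_continuousOn huc
  have hM0 : 0 ≤ M := (norm_nonneg _).trans (hM x (subset_closure hx))
  -- At distance `r` the penalty exceeds the oscillation `2 * M` of `u`, which keeps the maximum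
  -- point inside `Ω`.
  obtain ⟨A, hA0, hA⟩ : ∃ A : ℝ, 0 < A ∧ 2 * M < A * r ^ 2 := by
    refine ⟨(2 * M + 1) / r ^ 2, by positivity, ?_⟩
    rw [div_mul_cancel₀ _ (by positivity)]; linarith
  have hφ : ContDiff ℝ 1 fun y : EuclideanSpace ℝ (Fin n) => A * ‖y - x‖ ^ 2 :=
    contDiff_const.mul ((contDiff_id.sub contDiff_const).norm_sq ℝ)
  obtain ⟨y, hy, hmax⟩ := hcpt.exists_isMaxOn ⟨x, subset_closure hx⟩
    (huc.sub hφ.continuous.continuousOn)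
  have h1 : u x ≤ u y - A * ‖y - x‖ ^ 2 := by simpa using hmax (subset_closure hx)
  have hyΩ : y ∈ Ω := by
    apply hball
    rw [mem_ball, dist_eq_norm]
    by_contra hlt
    have h2 := hM x (subset_closure hx)
    have h3 := hM y hy
    rw [Real.norm_eq_abs, abs_le] at h2 h3
    have h4 : r ^ 2 ≤ ‖y - x‖ ^ 2 := pow_le_pow_left₀ hr.le (not_lt.1 hlt) 2
    have h5 := mul_le_mul_of_nonneg_left h4 hA0.le
    linarith
  have h := hu.2 y hyΩ _ hφ (hmax.on_subset subset_closure).localize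
  have h2 := hC y (gradient (fun z : EuclideanSpace ℝ (Fin n) => A * ‖z - x‖ ^ 2) y)
  have h3 : 0 ≤ A * ‖y - x‖ ^ 2 := by positivity
  linarith

/-- Exponential decay away from the boundary of nonnegative subsolutions in a ball. -/
theorem le_exp_of_isViscositySubsolution
    {H : EuclideanSpace ℝ (Fin n) → EuclideanSpace ℝ (Fin n) → ℝ} {C : ℝ} (hC : 0 < C)
    (hCb : ∀ x p, -H x p ≤ C) (hCp : ∀ x p, H x p ≤ 0 → -H x p ≤ C * ‖p‖) {k : ℝ} (hk : 0 < k)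
    {u : EuclideanSpace ℝ (Fin n) → ℝ} (hu : IsViscositySubsolution H (ball 0 k) u)
    (huc : ContinuousOn u (closedBall 0 k)) (hu0 : ∀ x ∈ closedBall 0 k, 0 ≤ u x)
    {x : EuclideanSpace ℝ (Fin n)} (hx : x ∈ closedBall 0 k) :
    u x ≤ C * Real.exp ((‖x‖ - k) / C) := by
  have hcpt : IsCompact (closedBall (0 : EuclideanSpace ℝ (Fin n)) k) := isCompact_closedBall _ _
  have key : ∀ δ : ℝ, 0 < δ → u x ≤ C * Real.exp ((‖x‖ + δ - k) / C) := by
    intro δ hδ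
    set w : EuclideanSpace ℝ (Fin n) → ℝ := fun y => C * Real.exp ((smoothNorm δ y - k) / C) with hw
    have hwc : ContDiff ℝ 1 w := contDiff_const.mul
      (((contDiff_smoothNorm hδ).sub contDiff_const).div_const C).exp
    have hgrad : ∀ y, C * ‖gradient w y‖ ≤ w y := by
      intro y
      have hd : HasFDerivAt w (C • (Real.exp ((smoothNorm δ y - k) / C) •
          (C⁻¹ • fderiv ℝ (smoothNorm δ) y))) y := by
        have h1 := ((differentiable_smoothNorm hδ y).hasFDerivAt.sub_const k).const_mul C⁻¹
        have h2 := h1.exp.const_mul C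
        simpa only [hw, div_eq_inv_mul] using h2
      rw [norm_gradient_eq, hd.fderiv, norm_smul, norm_smul, norm_smul, Real.norm_of_nonneg hC.le,
        Real.norm_of_nonneg (Real.exp_pos _).le, Real.norm_of_nonneg (inv_pos.2 hC).le]
      have h3 := mul_le_mul_of_nonneg_left (norm_fderiv_smoothNorm_le hδ y)
        (mul_pos hC (Real.exp_pos ((smoothNorm δ y - k) / C))).le
      calc _ = C * Real.exp ((smoothNorm δ y - k) / C) * ‖fderiv ℝ (smoothNorm δ) y‖ := by
            field_simp
        _ ≤ _ := by simpa [hw] using h3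
    obtain ⟨y, hy, hmax⟩ := hcpt.exists_isMaxOn ⟨x, hx⟩ (huc.sub hwc.continuous.continuousOn)
    have hyw : u y ≤ w y := by
      by_cases hyb : y ∈ ball (0 : EuclideanSpace ℝ (Fin n)) k
      · have h := hu.2 y hyb w hwc (hmax.on_subset ball_subset_closedBall).localize
        have h1 := hu0 y hy
        -- Nonnegativity of `u y` forces `H ≤ 0` at this gradient, so the linear bound applies.
        have h2 := hCp y (gradient w y) (by linarith)
        linarith [hgrad y]
      · have h1 : u y ≤ C := by
          refine le_of_isViscositySubsolution hCb isOpen_ball ?_ hu ?_ ?_ <;>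
            rwa [closure_ball _ hk.ne']
        have h2 : k ≤ ‖y‖ := by simpa using hyb
        have h3 : 0 ≤ (smoothNorm δ y - k) / C :=
          div_nonneg (by linarith [norm_le_smoothNorm δ y]) hC.le
        have h4 := mul_le_mul_of_nonneg_left (Real.one_le_exp h3) hC.le
        simp only [hw]
        linarith
    have h1 : u x - w x ≤ u y - w y := hmax hx
    have h2 : w x ≤ C * Real.exp ((‖x‖ + δ - k) / C) := by
      have := smoothNorm_le hδ.le x
      simp only [hw]
      gcongr
    linarith
  have hlim : Tendsto (fun δ : ℝ => C * Real.exp ((‖x‖ + δ - k) / C)) (𝓝[>] 0)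
      (𝓝 (C * Real.exp ((‖x‖ - k) / C))) := by
    have : Continuous fun δ : ℝ => C * Real.exp ((‖x‖ + δ - k) / C) := by fun_prop
    simpa using (this.tendsto 0).mono_left nhdsWithin_le_nhds
  exact ge_of_tendsto hlim (eventually_mem_nhdsWithin.mono key)

theorem mul_exp_mul_exp_neg (C r k : ℝ) :
    (C * Real.exp (r / C)) * Real.exp (-k / C) = C * Real.exp ((r - k) / C) := by
  rw [mul_assoc, ← Real.exp_add]
  ring_nf

/-- Coercivity confines `H ≤ 0` to a bounded set of `p`, where `H` is Lipschitz and vanishes at `0`.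
The maximum of the two constants serves both as boundary value and as decay length. -/
theorem IsAdmissibleHamiltonian.exists_rate
    {H : EuclideanSpace ℝ (Fin n) → EuclideanSpace ℝ (Fin n) → ℝ}
    (hH : IsAdmissibleHamiltonian H) (h0 : ∀ x, H x 0 = 0) :
    ∃ C : ℝ, 0 < C ∧ (∀ x p, -H x p ≤ C) ∧ ∀ x p, H x p ≤ 0 → -H x p ≤ C * ‖p‖ := by
  obtain ⟨C, hC0, hC⟩ := hH.bounded_below
  obtain ⟨r, hr⟩ := hH.coercive 1
  obtain ⟨L, hL0, hL⟩ := hH.exists_abs_le h0 r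
  refine ⟨max C L, by positivity, fun x p => (hC x p).trans (le_max_left _ _), fun x p hp => ?_⟩
  have hpr : ‖p‖ ≤ r := by
    by_contra! hlt
    linarith [hr p hlt.le x]
  exact (neg_le_abs _).trans ((hL x p hpr).trans
    (mul_le_mul_of_nonneg_right (le_max_right _ _) (norm_nonneg _)))

/-! ### Optimality: the extremal Hamiltonian and its solution -/

/-- The Hamiltonian realizing the exponential rate with constant `C`. -/
noncomputable def sharpHamiltonian (C : ℝ) (_x p : EuclideanSpace ℝ (Fin n)) : ℝ :=
  C * |‖p‖ - 1| - C

theorem isAdmissibleHamiltonian_sharpHamiltonian {C : ℝ} (hC : 0 < C) :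
    IsAdmissibleHamiltonian (sharpHamiltonian (n := n) C) where
  continuous := by unfold sharpHamiltonian; fun_prop
  bounded_below := ⟨C, hC, fun x p => by
    have : 0 ≤ C * |‖p‖ - 1| := by positivity
    unfold sharpHamiltonian; linarith⟩
  bounded_at_zero := ⟨C, hC, fun x => by simp [sharpHamiltonian, hC.le]⟩
  locally_lipschitz := fun R _ => ⟨C, fun x y p q _ _ => ⟨by
    simp only [sharpHamiltonian, sub_self, abs_zero]; positivity, by
    have h1 : |(|‖p‖ - 1| - |‖q‖ - 1|)| ≤ ‖p - q‖ :=
      (abs_abs_sub_abs_le _ _).trans (by simpa using abs_norm_sub_norm_le p q)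
    calc |sharpHamiltonian C x p - sharpHamiltonian C x q|
        = |C * (|‖p‖ - 1| - |‖q‖ - 1|)| := by unfold sharpHamiltonian; ring_nf
      _ = C * |(|‖p‖ - 1| - |‖q‖ - 1|)| := by rw [abs_mul, abs_of_pos hC]
      _ ≤ _ := by gcongr⟩⟩
  coercive := fun M => ⟨M / C + 2, fun p hp x => by
    have h1 := mul_le_mul_of_nonneg_left ((sub_le_sub_right hp 1).trans (le_abs_self _)) hC.le
    have h2 : C * (M / C) = M := mul_div_cancel₀ _ hC.ne'
    unfold sharpHamiltonian
    nlinarith⟩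

theorem isProductHamiltonian_sharpHamiltonian (C : ℝ) :
    IsProductHamiltonian (sharpHamiltonian (n := n) C) :=
  ⟨fun _ => 1, fun p => sharpHamiltonian C 0 p, 1, 1, by simp [sharpHamiltonian],
    by simp [sharpHamiltonian], ⟨uniformContinuous_const.uniformContinuousOn, 1, by simp⟩,
    one_pos, by simp⟩

/-- Selects the plane wave touching the radial profile at `x`. At the origin any direction works,
but a unit vector must exist, hence `1 ≤ n`. -/
theorem exists_norm_eq_one_inner_eq_norm (hn : 1 ≤ n) (x : EuclideanSpace ℝ (Fin n)) :
    ∃ ν : EuclideanSpace ℝ (Fin n), ‖ν‖ = 1 ∧ inner ℝ ν x = ‖x‖ := by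
  by_cases hx : x = 0
  · exact ⟨EuclideanSpace.single ⟨0, hn⟩ 1, by simp, by simp [hx]⟩
  · have hx' : ‖x‖ ≠ 0 := norm_ne_zero_iff.2 hx
    refine ⟨‖x‖⁻¹ • x, by simp [norm_smul, hx'], ?_⟩
    rw [real_inner_smul_left, real_inner_self_eq_norm_sq]
    field_simp

/-- An exponential plane wave, used as a test function. -/
noncomputable def expWave (C k : ℝ) (ν x : EuclideanSpace ℝ (Fin n)) : ℝ :=
  C * Real.exp ((inner ℝ ν x - k) / C)

theorem contDiff_expWave (C k : ℝ) (ν : EuclideanSpace ℝ (Fin n)) :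
    ContDiff ℝ 1 (expWave C k ν) := by
  unfold expWave
  exact contDiff_const.mul
    (((contDiff_const.inner ℝ contDiff_id).sub contDiff_const).div_const C).exp

/-- Makes the waves smooth minorants of the radial profile, usable even at the origin, where the
norm is not differentiable. -/
theorem expWave_le {C : ℝ} (hC : 0 < C) (k : ℝ) {ν : EuclideanSpace ℝ (Fin n)} (hν : ‖ν‖ = 1)
    (x : EuclideanSpace ℝ (Fin n)) : expWave C k ν x ≤ C * Real.exp ((‖x‖ - k) / C) := by
  have : inner ℝ ν x ≤ ‖x‖ := by simpa [hν] using real_inner_le_norm ν x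
  unfold expWave
  gcongr

theorem norm_gradient_expWave {C : ℝ} (hC : 0 < C) (k : ℝ) {ν : EuclideanSpace ℝ (Fin n)}
    (hν : ‖ν‖ = 1) (x : EuclideanSpace ℝ (Fin n)) :
    ‖gradient (expWave C k ν) x‖ = Real.exp ((inner ℝ ν x - k) / C) := by
  have hd : HasFDerivAt (expWave C k ν) (C • (Real.exp ((inner ℝ ν x - k) / C) •
      (C⁻¹ • innerSL ℝ ν))) x := by
    have h1 := (((innerSL ℝ ν).hasFDerivAt (x := x)).sub_const k).const_mul C⁻¹
    have h2 := h1.exp.const_mul C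
    simpa only [funext fun y => expWave.eq_1 C k ν y, div_eq_inv_mul, innerSL_apply_apply] using h2
  rw [norm_gradient_eq, hd.fderiv, norm_smul, norm_smul, norm_smul, Real.norm_of_nonneg hC.le,
    Real.norm_of_nonneg (Real.exp_pos _).le, Real.norm_of_nonneg (inv_pos.2 hC).le,
    innerSL_apply_norm, hν]
  field_simp

theorem sharpHamiltonian_of_norm_le {C : ℝ} {x p : EuclideanSpace ℝ (Fin n)} (hp : ‖p‖ ≤ 1) :
    sharpHamiltonian C x p = -(C * ‖p‖) := by
  rw [sharpHamiltonian, abs_of_nonpos (by linarith)]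
  ring

theorem neg_sharpHamiltonian_le {C : ℝ} (hC : 0 < C) (x p : EuclideanSpace ℝ (Fin n)) :
    -(C * ‖p‖) ≤ sharpHamiltonian C x p := by
  have := mul_le_mul_of_nonneg_left (neg_le_abs (‖p‖ - 1)) hC.le
  unfold sharpHamiltonian
  linarith

theorem eq_exp_of_isStateConstraintSolution_sharpHamiltonian (hn : 1 ≤ n) {C : ℝ} (hC : 0 < C)
    {k : ℝ} (hk : 0 < k) {u : EuclideanSpace ℝ (Fin n) → ℝ}
    (hu : IsStateConstraintSolution (sharpHamiltonian C) (ball 0 k) u)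
    {x : EuclideanSpace ℝ (Fin n)} (hx : x ∈ closedBall 0 k) :
    u x = C * Real.exp ((‖x‖ - k) / C) := by
  obtain ⟨hsub, hsup⟩ := hu
  rw [closure_ball _ hk.ne'] at hsup
  have hcpt : IsCompact (closedBall (0 : EuclideanSpace ℝ (Fin n)) k) := isCompact_closedBall _ _
  have huc := hsup.1.1.continuousOn
  apply le_antisymm
  · refine le_exp_of_isViscositySubsolution hC (fun x p => ?_)
      (fun x p _ => by linarith [neg_sharpHamiltonian_le hC x p]) hk hsub huc
      (fun y hy => nonneg_of_isViscositySupersolution (fun x => by simp [sharpHamiltonian])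
        hcpt hsup hy) hx
    have : 0 ≤ C * |‖p‖ - 1| := by positivity
    unfold sharpHamiltonian; linarith
  · have hwc : Continuous fun y : EuclideanSpace ℝ (Fin n) => C * Real.exp ((‖y‖ - k) / C) := by
      fun_prop
    obtain ⟨y, hy, hmin⟩ := hcpt.exists_isMinOn ⟨x, hx⟩ (huc.sub hwc.continuousOn)
    obtain ⟨ν, hν, hνy⟩ := exists_norm_eq_one_inner_eq_norm hn y
    have hyk : ‖y‖ ≤ k := by simpa using hy
    -- The wave lies below the profile and agrees with it at `y`, so `y` remains a minimum. The
    -- supersolution test holds on the sphere too, so no boundary case arises.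
    have h := hsup.2 y hy (expWave C k ν) (contDiff_expWave C k ν) (by
      refine IsMinOn.localize fun z hz => ?_
      have h1 : u y - C * Real.exp ((‖y‖ - k) / C) ≤ u z - C * Real.exp ((‖z‖ - k) / C) := hmin hz
      have h2 := expWave_le hC k hν z
      have h3 : expWave C k ν y = C * Real.exp ((‖y‖ - k) / C) := by rw [expWave, hνy]
      show u y - expWave C k ν y ≤ u z - expWave C k ν z
      linarith)
    have hp := norm_gradient_expWave hC k hν y
    rw [hνy] at hp
    rw [sharpHamiltonian_of_norm_le, hp] at h
    · have h1 : u y - C * Real.exp ((‖y‖ - k) / C) ≤ u x - C * Real.exp ((‖x‖ - k) / C) := hmin hx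
      linarith
    · rw [hp, Real.exp_le_one_iff]
      exact div_nonpos_of_nonpos_of_nonneg (by linarith) hC.le

/-- A test function touching `u` from above also touches the wave through that point from above, so
it has the wave's gradient and the equation holds with equality. -/
theorem isViscositySubsolution_sharpHamiltonian (hn : 1 ≤ n) {C : ℝ} (hC : 0 < C) {k : ℝ}
    {u : EuclideanSpace ℝ (Fin n) → ℝ} (hB : IsBUCOn u (ball 0 k))
    (hu : ∀ x ∈ ball 0 k, u x = C * Real.exp ((‖x‖ - k) / C)) :
    IsViscositySubsolution (sharpHamiltonian C) (ball 0 k) u := by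
  refine ⟨hB, fun x hx φ hφ hmax => ?_⟩
  obtain ⟨ν, hν, hνx⟩ := exists_norm_eq_one_inner_eq_norm hn x
  have hxk : ‖x‖ < k := by simpa using hx
  have hloc : IsLocalMax (fun y => expWave C k ν y - φ y) x := by
    have hnhds := isOpen_ball.mem_nhds hx
    rw [IsLocalMaxOn, IsMaxFilter, nhdsWithin_eq_nhds.2 hnhds] at hmax
    filter_upwards [hmax, hnhds] with z hz hzb
    rw [hu z hzb, hu x hx] at hz
    have h3 : expWave C k ν x = C * Real.exp ((‖x‖ - k) / C) := by rw [expWave, hνx]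
    linarith [expWave_le hC k hν z]
  have hd1 := (contDiff_expWave C k ν).differentiable (by norm_num) x
  have hd2 := hφ.differentiable (by norm_num) x
  have hg : fderiv ℝ φ x = fderiv ℝ (expWave C k ν) x := by
    have := hloc.fderiv_eq_zero
    rw [fderiv_fun_sub hd1 hd2, sub_eq_zero] at this
    exact this.symm
  have hp : ‖gradient φ x‖ = Real.exp ((‖x‖ - k) / C) := by
    rw [norm_gradient_eq, hg, ← norm_gradient_eq, norm_gradient_expWave hC k hν, hνx]
  rw [sharpHamiltonian_of_norm_le, hp, hu x hx, add_neg_cancel]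
  rw [hp, Real.exp_le_one_iff]
  exact div_nonpos_of_nonpos_of_nonneg (by linarith) hC.le

/-- On the sphere `u = C` and `H ≥ -C` suffice. Inside, `φ` grows along its gradient `p` at rate
`‖p‖ ^ 2` and `u` at rate at most `s * ‖p‖`, whence `‖p‖ ≤ s`. -/
theorem isViscositySupersolution_sharpHamiltonian {C : ℝ} (hC : 0 < C) {k : ℝ}
    {u : EuclideanSpace ℝ (Fin n) → ℝ} (hB : IsBUCOn u (closedBall 0 k))
    (hu : ∀ x ∈ closedBall 0 k, u x = C * Real.exp ((‖x‖ - k) / C)) :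
    IsViscositySupersolution (sharpHamiltonian C) (closedBall 0 k) u := by
  refine ⟨hB, fun x hx φ hφ hmin => ?_⟩
  have hxk : ‖x‖ ≤ k := by simpa using hx
  set p := gradient φ x with hp
  set s := Real.exp ((‖x‖ - k) / C) with hs
  rw [hu x hx]
  rcases hxk.eq_or_lt with hxk | hxk
  · have : s = 1 := by simp [hs, hxk]
    have h1 : 0 ≤ C * |‖p‖ - 1| := by positivity
    rw [← hs, this]
    unfold sharpHamiltonian; linarith
  have hball : ball (0 : EuclideanSpace ℝ (Fin n)) k ∈ 𝓝 x :=
    isOpen_ball.mem_nhds (by simpa using hxk)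
  suffices hps : ‖p‖ ≤ s by
    have := mul_le_mul_of_nonneg_left hps hC.le
    linarith [neg_sharpHamiltonian_le hC x p]
  -- along the ray `x + t p`, `t ≥ 0`
  have hline : HasDerivAt (fun t : ℝ => x + t • p) p 0 := by
    simpa using ((hasDerivAt_id (0 : ℝ)).smul_const p).const_add x
  have hφd : HasDerivAt (fun t : ℝ => φ (x + t • p)) (‖p‖ ^ 2) 0 := by
    have h1 : HasFDerivAt φ (fderiv ℝ φ x) (x + (0 : ℝ) • p) := by
      simpa using (hφ.differentiable (by norm_num) x).hasFDerivAt
    have h2 := h1.comp_hasDerivAt (0 : ℝ) hline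
    rwa [← inner_gradient_eq, ← hp, real_inner_self_eq_norm_sq] at h2
  -- Bounding `‖x + t • p‖` by `‖x‖ + t * ‖p‖` gives a majorant differentiable in `t` even when `x =
  -- 0`.
  have hed : HasDerivAt (fun t : ℝ => C * Real.exp ((‖x‖ + t * ‖p‖ - k) / C)) (s * ‖p‖) 0 := by
    have h1 : HasDerivAt (fun t : ℝ => (‖x‖ + t * ‖p‖ - k) / C) (‖p‖ / C) 0 := by
      simpa using ((((hasDerivAt_id (0 : ℝ)).mul_const ‖p‖).const_add ‖x‖).sub_const k).div_const C
    have h2 := h1.exp.const_mul C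
    refine h2.congr_deriv ?_
    rw [zero_mul, add_zero, ← hs]
    field_simp
  have hev : ∀ᶠ t : ℝ in 𝓝[>] 0,
      C * Real.exp ((‖x‖ - k) / C) - φ x ≤
        C * Real.exp ((‖x‖ + t * ‖p‖ - k) / C) - φ (x + t • p) := by
    have hmin' : ∀ᶠ y in 𝓝 x, u x - φ x ≤ u y - φ y := by
      have : closedBall (0 : EuclideanSpace ℝ (Fin n)) k ∈ 𝓝 x :=
        mem_of_superset hball ball_subset_closedBall
      rwa [IsLocalMinOn, IsMinFilter, nhdsWithin_eq_nhds.2 this] at hmin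
    have ht : Tendsto (fun t : ℝ => x + t • p) (𝓝[>] 0) (𝓝 x) := by
      simpa using hline.continuousAt.tendsto.mono_left nhdsWithin_le_nhds
    filter_upwards [ht.eventually hmin', ht.eventually hball, self_mem_nhdsWithin] with t h1 h2 h3
    rw [hu x hx, hu _ (ball_subset_closedBall h2)] at h1
    have h4 : ‖x + t • p‖ ≤ ‖x‖ + t * ‖p‖ := by
      refine (norm_add_le _ _).trans ?_
      rw [norm_smul, Real.norm_of_nonneg (le_of_lt h3)]
    have h5 : C * Real.exp ((‖x + t • p‖ - k) / C) ≤ C * Real.exp ((‖x‖ + t * ‖p‖ - k) / C) := by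
      gcongr
    linarith
  have hle : 0 ≤ s * ‖p‖ - ‖p‖ ^ 2 := by
    have hslope := (hasDerivWithinAt_iff_tendsto_slope' (Set.self_notMem_Ioi (a := (0 : ℝ)))).1
      (hed.sub hφd).hasDerivWithinAt
    refine ge_of_tendsto hslope ?_
    filter_upwards [hev, self_mem_nhdsWithin] with t h1 h2
    rw [slope_def_field]
    refine div_nonneg ?_ (by simpa using le_of_lt h2)
    simp only [Pi.sub_apply, zero_mul, add_zero, zero_smul]
    linarith
  have hs0 : 0 < s := Real.exp_pos _
  by_contra! hlt
  nlinarith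

theorem isStateConstraintSolution_sharpHamiltonian_iff (hn : 1 ≤ n) {C : ℝ} (hC : 0 < C)
    {k : ℝ} (hk : 0 < k) (u : EuclideanSpace ℝ (Fin n) → ℝ) :
    IsStateConstraintSolution (sharpHamiltonian C) (ball 0 k) u ↔
      ∀ x ∈ closedBall 0 k, u x = C * Real.exp ((‖x‖ - k) / C) := by
  refine ⟨fun hu x hx => eq_exp_of_isStateConstraintSolution_sharpHamiltonian hn hC hk hu hx,
    fun hu => ?_⟩
  have hcpt : IsCompact (closedBall (0 : EuclideanSpace ℝ (Fin n)) k) := isCompact_closedBall _ _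
  have hwc : Continuous fun y : EuclideanSpace ℝ (Fin n) => C * Real.exp ((‖y‖ - k) / C) := by
    fun_prop
  have huc : ContinuousOn u (closedBall 0 k) := hwc.continuousOn.congr hu
  have hB : IsBUCOn u (closedBall 0 k) :=
    ⟨hcpt.uniformContinuousOn_of_continuous huc, hcpt.exists_bound_of_continuousOn huc⟩
  have hB' : IsBUCOn u (ball 0 k) :=
    ⟨hB.1.mono ball_subset_closedBall, hB.2.imp fun M hM x hx => hM x (ball_subset_closedBall hx)⟩
  refine ⟨isViscositySubsolution_sharpHamiltonian hn hC hB'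
    fun x hx => hu x (ball_subset_closedBall hx), ?_⟩
  rw [closure_ball _ hk.ne']
  exact isViscositySupersolution_sharpHamiltonian hC hB hu

theorem theorem1p2 (n : ℕ) (hn : 1 ≤ n) :
    (∀ H : EuclideanSpace ℝ (Fin n) → EuclideanSpace ℝ (Fin n) → ℝ,
      IsAdmissibleHamiltonian H → IsProductHamiltonian H →
        (∀ u : EuclideanSpace ℝ (Fin n) → ℝ,
          IsStateConstraintSolution H Set.univ u ↔ ∀ x, u x = 0) ∧
        ∃ C : ℝ, 0 < C ∧
          ∀ k : ℕ, 1 ≤ k → ∀ u : EuclideanSpace ℝ (Fin n) → ℝ,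
            IsStateConstraintSolution H (Metric.ball 0 (k : ℝ)) u →
              (∀ x ∈ Metric.closedBall (0 : EuclideanSpace ℝ (Fin n)) (k : ℝ),
                0 ≤ u x ∧ u x ≤ (C * Real.exp (‖x‖ / C)) * Real.exp (-(k : ℝ) / C)) ∧
              (∀ R : ℝ, 0 < R → R ≤ (k : ℝ) →
                ∀ x ∈ Metric.closedBall (0 : EuclideanSpace ℝ (Fin n)) R,
                  0 ≤ u x ∧ u x ≤ (C * Real.exp (R / C)) * Real.exp (-(k : ℝ) / C))) ∧
    (∀ C : ℝ, 0 < C →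
      ∃ H : EuclideanSpace ℝ (Fin n) → EuclideanSpace ℝ (Fin n) → ℝ,
        IsAdmissibleHamiltonian H ∧ IsProductHamiltonian H ∧
          ∀ k : ℕ, 1 ≤ k → ∀ u : EuclideanSpace ℝ (Fin n) → ℝ,
            IsStateConstraintSolution H (Metric.ball 0 (k : ℝ)) u ↔
              ∀ x ∈ Metric.closedBall (0 : EuclideanSpace ℝ (Fin n)) (k : ℝ),
                u x = (C * Real.exp (‖x‖ / C)) * Real.exp (-(k : ℝ) / C)) := by
  constructor
  · intro H hH hP
    have h0 := hP.apply_zero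
    refine ⟨isStateConstraintSolution_univ_iff hH h0, ?_⟩
    obtain ⟨C, hC, hCb, hCp⟩ := hH.exists_rate h0
    refine ⟨C, hC, fun k hk u hu => ?_⟩
    have hk0 : (0 : ℝ) < k := by exact_mod_cast hk
    obtain ⟨hsub, hsup⟩ := hu
    rw [closure_ball _ hk0.ne'] at hsup
    have hu0 : ∀ x ∈ closedBall 0 (k : ℝ), 0 ≤ u x := fun x hx =>
      nonneg_of_isViscositySupersolution h0 (isCompact_closedBall _ _) hsup hx
    have hle : ∀ x ∈ closedBall 0 (k : ℝ), u x ≤ C * Real.exp ((‖x‖ - k) / C) := fun x hx =>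
      le_exp_of_isViscositySubsolution hC hCb hCp hk0 hsub hsup.1.1.continuousOn hu0 hx
    simp only [mul_exp_mul_exp_neg]
    refine ⟨fun x hx => ⟨hu0 x hx, hle x hx⟩, fun R _ hRk x hx => ?_⟩
    have hxk := closedBall_subset_closedBall hRk hx
    have hxR : ‖x‖ ≤ R := by simpa using hx
    exact ⟨hu0 x hxk, (hle x hxk).trans (by gcongr)⟩
  · intro C hC
    refine ⟨sharpHamiltonian C, isAdmissibleHamiltonian_sharpHamiltonian hC,
      isProductHamiltonian_sharpHamiltonian C, fun k hk u => ?_⟩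
    simp only [mul_exp_mul_exp_neg]
    exact isStateConstraintSolution_sharpHamiltonian_iff hn hC (by exact_mod_cast hk) u
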